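/- Let $\mathcal{S}$ be the class of functions $f$ that are analytic and univalent (injective) in the open unit disk $\mathbb{D}=\{z\in\mathbb{C}:|z|<1\}$ and are normalized by $f(0)=0$, $f'(0)=1$. If $f\in\mathcal{S}$ has the expansion $f(z)=z+\sum_{n=2}^{\infty}a_nz^n$ for $z\in\mathbb{D}$, then $$|a_4|-|a_3|\le 2.1033299.$$ -/

import Mathlib

open scoped Nat

/-- The class `𝒮` of normalized univalent functions: functions that are analytic and injective
in the open unit disk `{z : |z| < 1}`, with `f 0 = 0` and `f' 0 = 1`. (Values of `f` outside the
disk are irrelevant.) -/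
def ClassS : Set (ℂ → ℂ) :=
  {f | AnalyticOnNhd ℂ f (Metric.ball 0 1) ∧ Set.InjOn f (Metric.ball 0 1) ∧
    f 0 = 0 ∧ deriv f 0 = 1}

/-- The `n`-th Taylor coefficient `a_n` of `f` at the origin. -/
noncomputable def taylorCoeff (f : ℂ → ℂ) (n : ℕ) : ℂ :=
  iteratedDeriv n f 0 / (n ! : ℂ)

/-- For `f ∈ 𝒮` the coefficients are those of the expansion `f z = ∑ a_n z ^ n` in the disk. -/
theorem ClassS.hasSum {f : ℂ → ℂ} (hf : f ∈ ClassS) {z : ℂ} (hz : z ∈ Metric.ball (0 : ℂ) 1) :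
    HasSum (fun n : ℕ => taylorCoeff f n * z ^ n) (f z) := by
  have h := Complex.hasSum_taylorSeries_on_ball (c := 0) (r := 1)
    (f := f) (by simpa using hf.1.differentiableOn) (z := z) (by simpa using hz)
  have e : (fun n : ℕ => taylorCoeff f n * z ^ n) =
      fun n : ℕ => (n ! : ℂ)⁻¹ • (z - 0) ^ n • iteratedDeriv n f 0 := by
    funext n
    simp only [taylorCoeff, div_eq_mul_inv, sub_zero, smul_eq_mul]
    ring
  rw [e]
  exact h

/-- The normalization in terms of coefficients: `a_0 = 0` and `a_1 = 1`. -/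
theorem ClassS.taylorCoeff_zero_one {f : ℂ → ℂ} (hf : f ∈ ClassS) :
    taylorCoeff f 0 = 0 ∧ taylorCoeff f 1 = 1 := by
  obtain ⟨-, -, h0, h1⟩ := hf
  simp [taylorCoeff, h0, h1]

/-! ### Taylor coefficients -/

/-! Let `m` be the branch of `(z / f z) ^ (1/2)` with `m 0 = 1`, and let `m₁, m₂, m₃` be its next
coefficients. The function `m (z ^ 2) / z = z⁻¹ + m₁ z + m₂ z ^ 3 + m₃ z ^ 5 + ⋯` is injective in
the punctured disk, so Gronwall's area theorem (`area_theorem`) gives `|m₁|² + 3|m₂|² + 5|m₃|² ≤ 1`,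
and in particular `|m₁| ≤ 1`. Comparing coefficients in `m² f = z` gives `a₄ + m₁ a₃ = -m₁³ + 4 m₁
m₂ - 2 m₃`. As `|m₁ a₃| ≤ |a₃|`, the difference `|a₄| - |a₃|` is at most `|m₁|³ + 4|m₁||m₂| +
2|m₃|`, which the area inequality bounds by `2.1`.

The area theorem is proved without describing the omitted set of `g = z⁻¹ + G`. The weight `1 -
ε²|w|²` is integrated over the image of the annulus `ε ≤ |z| ≤ s`. Injectivity bounds this by the
integral of the positive part over the plane, `π / (2ε²)`. Polar coordinates and orthogonality of
powers on circles bound it below. The terms of order `ε⁻²` cancel exactly, and letting `ε → 0` and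
then `s → 1` leaves the inequality. -/

theorem taylorCoeff_congr {f g : ℂ → ℂ} (h : f =ᶠ[nhds 0] g) (n : ℕ) :
    taylorCoeff f n = taylorCoeff g n := by
  rw [taylorCoeff, taylorCoeff, h.iteratedDeriv_eq]

theorem taylorCoeff_mul {f g : ℂ → ℂ} (hf : AnalyticAt ℂ f 0) (hg : AnalyticAt ℂ g 0) (n : ℕ) :
    taylorCoeff (fun z => f z * g z) n =
      ∑ i ∈ Finset.range (n + 1), taylorCoeff f i * taylorCoeff g (n - i) := by
  simp only [taylorCoeff]
  rw [iteratedDeriv_fun_mul hf.contDiffAt hg.contDiffAt, Finset.sum_div]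
  refine Finset.sum_congr rfl fun i hi => ?_
  have hin : i ≤ n := by simpa [Nat.lt_succ_iff] using hi
  rw [Nat.cast_choose ℂ hin]
  have h1 : (n ! : ℂ) ≠ 0 := by exact_mod_cast n.factorial_ne_zero
  have h2 : (i ! : ℂ) ≠ 0 := by exact_mod_cast i.factorial_ne_zero
  have h3 : ((n - i)! : ℂ) ≠ 0 := by exact_mod_cast (n - i).factorial_ne_zero
  field_simp

theorem taylorCoeff_id (n : ℕ) : taylorCoeff (fun z => z) n = if n = 1 then 1 else 0 := by
  rw [taylorCoeff, iteratedDeriv_fun_id]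
  rcases n with _ | _ | n <;> simp

theorem taylorCoeff_const_add_mul_succ (c : ℂ) {F : ℂ → ℂ} (hF : AnalyticAt ℂ F 0) (n : ℕ) :
    taylorCoeff (fun z => c + z * F z) (n + 1) = taylorCoeff F n := by
  have h : taylorCoeff (fun z => c + z * F z) (n + 1) =
      taylorCoeff (fun z => z * F z) (n + 1) := by
    simp only [taylorCoeff, iteratedDeriv_const_add n.succ_pos]
  rw [h, taylorCoeff_mul (f := fun z => z) analyticAt_id hF, Finset.sum_eq_single 1]
  · simp [taylorCoeff_id]
  · intro i _ hi
    simp [taylorCoeff_id, hi]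
  · simp

theorem taylorCoeff_zero (f : ℂ → ℂ) : taylorCoeff f 0 = f 0 := by simp [taylorCoeff]

theorem taylorCoeff_deriv (f : ℂ → ℂ) (n : ℕ) :
    taylorCoeff (deriv f) n = (n + 1) * taylorCoeff f (n + 1) := by
  rw [taylorCoeff, taylorCoeff, iteratedDeriv_succ', Nat.factorial_succ]
  have h1 : (n ! : ℂ) ≠ 0 := by exact_mod_cast n.factorial_ne_zero
  have h2 : (n + 1 : ℂ) ≠ 0 := by exact_mod_cast n.succ_ne_zero
  push_cast
  field_simp

theorem eq_add_mul_dslope (f : ℂ → ℂ) (z : ℂ) : f z = f 0 + z * dslope f 0 z := by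
  have h := sub_smul_dslope f 0 z
  simp only [sub_zero, smul_eq_mul] at h
  rw [h]; ring

theorem AnalyticAt.of_differentiableOn_unitBall {f : ℂ → ℂ}
    (hf : DifferentiableOn ℂ f (Metric.ball 0 1)) : AnalyticAt ℂ f 0 :=
  hf.analyticAt (Metric.ball_mem_nhds 0 one_pos)

theorem DifferentiableOn.dslope_unitBall {f : ℂ → ℂ}
    (hf : DifferentiableOn ℂ f (Metric.ball 0 1)) :
    DifferentiableOn ℂ (dslope f 0) (Metric.ball 0 1) :=
  (Complex.differentiableOn_dslope (Metric.ball_mem_nhds 0 one_pos)).2 hf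

theorem taylorCoeff_dslope {f : ℂ → ℂ} (hf : DifferentiableOn ℂ f (Metric.ball 0 1)) (n : ℕ) :
    taylorCoeff (dslope f 0) n = taylorCoeff f (n + 1) := by
  rw [← taylorCoeff_const_add_mul_succ (f 0) (.of_differentiableOn_unitBall hf.dslope_unitBall)]
  exact congrArg (taylorCoeff · (n + 1)) (funext fun z => (eq_add_mul_dslope f z).symm)

/-! ### Circle averages -/

open Real MeasureTheory

theorem sphere_subset_unitBall {r : ℝ} (h0 : 0 ≤ r) (h1 : r < 1) :
    Metric.sphere (0 : ℂ) |r| ⊆ Metric.ball 0 1 := by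
  intro z hz
  simp only [mem_sphere_zero_iff_norm, abs_of_nonneg h0] at hz
  simpa [hz] using h1

theorem circleAverage_re_eq {F : ℂ → ℂ} (hF : DifferentiableOn ℂ F (Metric.ball 0 1)) {r : ℝ}
    (h0 : 0 ≤ r) (h1 : r < 1) : circleAverage (fun z => (F z).re) 0 r = (F 0).re := by
  have hcl : Metric.closedBall (0 : ℂ) |r| ⊆ Metric.ball 0 1 := by
    rw [abs_of_nonneg h0]; exact Metric.closedBall_subset_ball h1
  have hd : DiffContOnCl ℂ F (Metric.ball 0 |r|) :=
    DifferentiableOn.diffContOnCl_ball hF hcl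
  have hi : CircleIntegrable F 0 r :=
    (hF.continuousOn.mono (sphere_subset_unitBall h0 h1)).circleIntegrable'
  have := Complex.reCLM.circleAverage_comp_comm hi
  rw [hd.circleAverage] at this
  exact this

/-- Orthogonality on a circle: the cross term is a real multiple of the real part of a holomorphic
function vanishing at `0`, so its mean is zero. -/
theorem circleAverage_normSq_add {A H F : ℂ → ℂ} {r α β : ℝ} (h0 : 0 ≤ r) (h1 : r < 1)
    (hH : ContinuousOn H (Metric.sphere 0 |r|)) (hF : DifferentiableOn ℂ F (Metric.ball 0 1))
    (hF0 : F 0 = 0) (hA : ∀ z, ‖z‖ = r → ‖A z‖ ^ 2 = α)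
    (hAH : ∀ z, ‖z‖ = r → (starRingEnd ℂ) (A z) * H z = β * F z) :
    circleAverage (fun z => ‖A z + H z‖ ^ 2) 0 r =
      α + circleAverage (fun z => ‖H z‖ ^ 2) 0 r := by
  have hs := sphere_subset_unitBall h0 h1
  have e : circleAverage (fun z => ‖A z + H z‖ ^ 2) 0 r =
      circleAverage (fun z => (α + ‖H z‖ ^ 2) + (2 * β) • (F z).re) 0 r := by
    refine circleAverage_congr_sphere fun z hz => ?_
    simp only [mem_sphere_zero_iff_norm, abs_of_nonneg h0] at hz
    simp only [smul_eq_mul]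
    rw [← hA z hz]
    have := congrArg Complex.re (hAH z hz)
    simp only [Complex.mul_re, Complex.conj_re, Complex.conj_im, Complex.ofReal_re,
      Complex.ofReal_im] at this
    simp only [← Complex.normSq_eq_norm_sq, Complex.normSq_apply, Complex.add_re, Complex.add_im]
    linarith
  have c1 : CircleIntegrable (fun z => ‖H z‖ ^ 2) 0 r := (hH.norm.pow 2).circleIntegrable'
  have c2 : CircleIntegrable (fun z => (F z).re) 0 r :=
    (Complex.continuous_re.comp_continuousOn (hF.continuousOn.mono hs)).circleIntegrable'
  have c3 : CircleIntegrable (fun _ : ℂ => α) 0 r := circleIntegrable_const _ _ _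
  have c4 : CircleIntegrable (fun z => α + ‖H z‖ ^ 2) 0 r := c3.add c1
  have c5 : CircleIntegrable (fun z => (2 * β) • (F z).re) 0 r := c2.const_smul
  rw [e, circleAverage_fun_add c4 c5, circleAverage_fun_add c3 c1,
    circleAverage_const, circleAverage_fun_smul, circleAverage_re_eq hF h0 h1, hF0]
  simp

theorem circleAverage_normSq_inv_pow_add {H : ℂ → ℂ} {r : ℝ} (h0 : 0 < r) (h1 : r < 1)
    (hH : DifferentiableOn ℂ H (Metric.ball 0 1)) {k : ℕ} (hk : k ≠ 0) :
    circleAverage (fun z => ‖-(z ^ k)⁻¹ + H z‖ ^ 2) 0 r =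
      (r ^ (2 * k))⁻¹ + circleAverage (fun z => ‖H z‖ ^ 2) 0 r := by
  refine circleAverage_normSq_add (F := fun z => z ^ k * H z) (β := -(r ^ (2 * k))⁻¹) h0.le h1
    (hH.continuousOn.mono (sphere_subset_unitBall h0.le h1))
    ((differentiableOn_id.pow k).mul hH) (by simp [hk]) (fun z hz => ?_) (fun z hz => ?_)
  · rw [norm_neg, norm_inv, norm_pow, hz, inv_pow, ← pow_mul, mul_comm]
  · have hz0 : z ≠ 0 := by rintro rfl; simp at hz; exact h0.ne hz
    -- On the circle, conjugation is `z ↦ r ^ 2 / z`, which turns the conjugate of `z ^ (-k)` into a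
    -- multiple of `z ^ k`.
    have hc : (starRingEnd ℂ) z * z = (r : ℂ) ^ 2 := by rw [Complex.conj_mul', hz]
    have hr : (r : ℂ) ≠ 0 := by exact_mod_cast h0.ne'
    have hcz : (starRingEnd ℂ) z ≠ 0 := by simpa using hz0
    simp only [map_neg, map_inv₀, map_pow]
    push_cast
    rw [pow_mul, ← hc, mul_pow]
    field_simp

theorem circleAverage_normSq_dslope {Q : ℂ → ℂ} {r : ℝ} (h0 : 0 ≤ r) (h1 : r < 1)
    (hQ : DifferentiableOn ℂ Q (Metric.ball 0 1)) :
    circleAverage (fun z => ‖Q z‖ ^ 2) 0 r =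
      ‖Q 0‖ ^ 2 + r ^ 2 * circleAverage (fun z => ‖dslope Q 0 z‖ ^ 2) 0 r := by
  have hd := hQ.dslope_unitBall
  have e : (fun z => ‖Q z‖ ^ 2) = fun z => ‖Q 0 + z * dslope Q 0 z‖ ^ 2 := by
    funext z; rw [← eq_add_mul_dslope]
  rw [e, circleAverage_normSq_add (A := fun _ => Q 0) (H := fun z => z * dslope Q 0 z)
    (F := fun z => (starRingEnd ℂ) (Q 0) * (z * dslope Q 0 z)) (β := 1) (α := ‖Q 0‖ ^ 2) h0 h1
    ((differentiableOn_id.mul hd).continuousOn.mono (sphere_subset_unitBall h0 h1))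
    ((differentiableOn_id.mul hd).const_mul _) (by simp) (by simp) (by simp)]
  congr 1
  rw [← smul_eq_mul, ← circleAverage_fun_smul]
  refine circleAverage_congr_sphere fun z hz => ?_
  simp only [mem_sphere_zero_iff_norm, abs_of_nonneg h0] at hz
  simp [hz, mul_pow]

/-- **Bessel's inequality** for the Taylor coefficients. -/
theorem sum_taylorCoeff_le_circleAverage {Q : ℂ → ℂ} {r : ℝ} (h0 : 0 ≤ r) (h1 : r < 1)
    (hQ : DifferentiableOn ℂ Q (Metric.ball 0 1)) (N : ℕ) :
    ∑ n ∈ Finset.range N, ‖taylorCoeff Q n‖ ^ 2 * r ^ (2 * n) ≤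
      circleAverage (fun z => ‖Q z‖ ^ 2) 0 r := by
  induction N generalizing Q with
  | zero =>
    simpa using circleAverage_nonneg_of_nonneg (f := fun z => ‖Q z‖ ^ 2) (c := 0) (R := r)
      fun z _ => by positivity
  | succ N ih =>
    rw [Finset.sum_range_succ', circleAverage_normSq_dslope h0 h1 hQ, add_comm, taylorCoeff_zero]
    simp only [mul_zero, pow_zero, mul_one]
    gcongr
    refine le_trans (le_of_eq ?_) (mul_le_mul_of_nonneg_left (ih hQ.dslope_unitBall) (sq_nonneg r))
    rw [Finset.mul_sum]
    refine Finset.sum_congr rfl fun n _ => ?_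
    rw [taylorCoeff_dslope hQ]
    ring

/-! ### Integration in polar coordinates -/

theorem circleMap_eq_polarCoord_symm (r θ : ℝ) :
    circleMap 0 r θ = Complex.polarCoord.symm (r, θ) := by
  simp [circleMap, Complex.exp_mul_I]

theorem setIntegral_annulus {F : ℂ → ℝ} {a b : ℝ} (ha : 0 < a) (hab : a ≤ b)
    (hF : ContinuousOn F {z | a ≤ ‖z‖ ∧ ‖z‖ ≤ b}) :
    ∫ z in {z : ℂ | a ≤ ‖z‖ ∧ ‖z‖ ≤ b}, F z =
      ∫ r in a..b, 2 * π * r * circleAverage F 0 r := by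
  have hm : MeasurableSet {z : ℂ | a ≤ ‖z‖ ∧ ‖z‖ ≤ b} :=
    (measurableSet_le measurable_const measurable_norm).inter
      (measurableSet_le measurable_norm measurable_const)
  have hcont : ContinuousOn (fun p : ℝ × ℝ => p.1 * F (circleMap 0 p.1 p.2))
      (Set.Icc a b ×ˢ Set.univ) := by
    refine continuousOn_fst.mul (hF.comp ?_ ?_)
    · have : Continuous fun p : ℝ × ℝ => circleMap 0 p.1 p.2 := by
        unfold circleMap; fun_prop
      exact this.continuousOn
    · rintro ⟨r, θ⟩ ⟨hr, -⟩
      have : |r| = r := abs_of_pos (ha.trans_le hr.1)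
      simpa [this] using hr
  have hint : IntegrableOn (fun p : ℝ × ℝ => p.1 * F (circleMap 0 p.1 p.2))
      (Set.Icc a b ×ˢ Set.Ioo (-π) π) (volume.prod volume) := by
    have : IntegrableOn (fun p : ℝ × ℝ => p.1 * F (circleMap 0 p.1 p.2))
        (Set.Icc a b ×ˢ Set.Icc (-π) π) (volume.prod volume) :=
      (hcont.mono (Set.prod_mono_right (Set.subset_univ _))).integrableOn_compact
        (isCompact_Icc.prod isCompact_Icc)
    exact this.mono_set (Set.prod_mono_right Set.Ioo_subset_Icc_self)
  have hsub : Set.Icc a b ×ˢ Set.Ioo (-π) π ⊆ polarCoord.target := by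
    rw [polarCoord_target]
    exact Set.prod_mono_left fun r hr => ha.trans_le hr.1
  rw [← integral_indicator hm, ← Complex.integral_comp_polarCoord_symm,
    setIntegral_eq_of_subset_of_forall_sdiff_eq_zero polarCoord.open_target.measurableSet hsub,
    setIntegral_congr_fun (g := fun p => p.1 * F (circleMap 0 p.1 p.2))
      (measurableSet_Icc.prod measurableSet_Ioo), Measure.volume_eq_prod, setIntegral_prod _ hint,
    intervalIntegral.integral_of_le hab, integral_Icc_eq_integral_Ioc]
  · refine setIntegral_congr_fun measurableSet_Ioc fun r _ => ?_
    have hper : Function.Periodic (fun θ => F (circleMap 0 r θ)) (2 * π) := fun θ => by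
      simp only [periodic_circleMap 0 r θ]
    have h1 : ∫ θ in (-π)..π, F (circleMap 0 r θ) = ∫ θ in 0..2 * π, F (circleMap 0 r θ) := by
      have := hper.intervalIntegral_add_eq (-π) 0
      rwa [zero_add, show -π + 2 * π = π by ring] at this
    simp only [integral_const_mul]
    rw [← integral_Ioc_eq_integral_Ioo, ← intervalIntegral.integral_of_le (by linarith [pi_pos]),
      h1, circleAverage, smul_eq_mul]
    field_simp
  · rintro ⟨r, θ⟩ ⟨hr, -⟩
    have h2 : |r| = r := abs_of_pos (ha.trans_le hr.1)
    have : circleMap 0 r θ ∈ {z : ℂ | a ≤ ‖z‖ ∧ ‖z‖ ≤ b} := by simpa [h2] using hr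
    simp only [← circleMap_eq_polarCoord_symm, Set.indicator_of_mem this, smul_eq_mul]
  · rintro ⟨r, θ⟩ ⟨hp, hn⟩
    rw [polarCoord_target] at hp
    have h2 : |r| = r := abs_of_pos hp.1
    have : circleMap 0 r θ ∉ {z : ℂ | a ≤ ‖z‖ ∧ ‖z‖ ≤ b} := fun h => hn ⟨by simpa [h2] using h, hp.2⟩
    simp only [← circleMap_eq_polarCoord_symm, Set.indicator_of_notMem this, smul_zero]

/-- The total mass available to any injective image under the weight. -/
theorem integral_max_one_sub_normSq {ε : ℝ} (hε : 0 < ε) :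
    ∫ w : ℂ, max (1 - ε ^ 2 * ‖w‖ ^ 2) 0 = π / (2 * ε ^ 2) := by
  rw [integral_fun_norm_addHaar volume fun x => max (1 - ε ^ 2 * x ^ 2) 0]
  have h1 : ∫ y in Set.Ioi (0 : ℝ), y ^ (Module.finrank ℝ ℂ - 1) • max (1 - ε ^ 2 * y ^ 2) 0 =
      ∫ y in (0 : ℝ)..ε⁻¹, (y - ε ^ 2 * y ^ 3) := by
    rw [intervalIntegral.integral_of_le (by positivity)]
    rw [setIntegral_eq_of_subset_of_forall_sdiff_eq_zero measurableSet_Ioi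
      (show Set.Ioc 0 ε⁻¹ ⊆ Set.Ioi 0 from Set.Ioc_subset_Ioi_self)]
    · refine setIntegral_congr_fun measurableSet_Ioc fun y hy => ?_
      have h2 : ε * y ≤ 1 := by
        have := mul_le_mul_of_nonneg_left hy.2 hε.le
        rwa [mul_inv_cancel₀ hε.ne'] at this
      have h3 : 0 ≤ 1 - ε ^ 2 * y ^ 2 := by
        have := pow_le_one₀ (n := 2) (mul_nonneg hε.le hy.1.le) h2
        rw [mul_pow] at this; linarith
      simp only [Complex.finrank_real_complex, max_eq_left h3, smul_eq_mul]
      ring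
    · rintro y ⟨hy0, hy⟩
      have h2 : 1 ≤ ε * y := by
        have : ε⁻¹ < y := by
          by_contra h
          exact hy ⟨hy0, not_lt.1 h⟩
        have := mul_le_mul_of_nonneg_left this.le hε.le
        rwa [mul_inv_cancel₀ hε.ne'] at this
      have h3 : 1 - ε ^ 2 * y ^ 2 ≤ 0 := by
        have := one_le_pow₀ (n := 2) h2
        rw [mul_pow] at this; linarith
      simp [max_eq_right h3]
  rw [h1, intervalIntegral.integral_sub (by simp) (by
    apply Continuous.intervalIntegrable; fun_prop), intervalIntegral.integral_const_mul]
  simp only [integral_id, integral_pow, Complex.finrank_real_complex, Measure.real,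
    Complex.volume_ball]
  simp
  field_simp
  ring

/-! ### The area theorem -/

theorem abs_det_restrictScalars_toSpanSingleton (c : ℂ) :
    |((ContinuousLinearMap.toSpanSingleton ℂ c : ℂ →L[ℂ] ℂ).restrictScalars ℝ).det| =
      ‖c‖ ^ 2 := by
  have : (ContinuousLinearMap.toSpanSingleton ℂ c : ℂ →L[ℂ] ℂ).det = c := by
    simp [ContinuousLinearMap.det]
  rw [ContinuousLinearMap.det, ContinuousLinearMap.coe_restrictScalars,
    LinearMap.det_restrictScalars, ← ContinuousLinearMap.det, this, Algebra.norm_complex_eq]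
  simp [Complex.normSq_eq_norm_sq]

/-- The image of a compact set under an injective holomorphic map has total mass at most
`π / (2 ε ^ 2)` for the weight `1 - ε ^ 2 ‖w‖ ^ 2`, which is positive only for `‖w‖ < ε⁻¹`. -/
theorem setIntegral_weight_le {K : Set ℂ} (hK : IsCompact K) {g g' : ℂ → ℂ}
    (hg : ∀ z ∈ K, HasDerivAt g (g' z) z) (hinj : Set.InjOn g K) {ε : ℝ} (hε : 0 < ε) :
    ∫ z in K, (1 - ε ^ 2 * ‖g z‖ ^ 2) * ‖g' z‖ ^ 2 ≤ π / (2 * ε ^ 2) := by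
  have hgc : ContinuousOn g K := fun z hz => (hg z hz).continuousAt.continuousWithinAt
  have h := integral_image_eq_integral_abs_det_fderiv_smul volume hK.measurableSet
    (fun z hz => ((hg z hz).hasFDerivAt.restrictScalars ℝ).hasFDerivWithinAt) hinj
    (fun w => 1 - ε ^ 2 * ‖w‖ ^ 2)
  simp only [abs_det_restrictScalars_toSpanSingleton, smul_eq_mul] at h
  simp_rw [mul_comm _ (‖g' _‖ ^ 2)]
  rw [← h, ← integral_max_one_sub_normSq hε]
  have hpos : ∀ w : ℂ, 0 ≤ max (1 - ε ^ 2 * ‖w‖ ^ 2) 0 := fun w => le_max_right _ _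
  have hcont : Continuous fun w : ℂ => max (1 - ε ^ 2 * ‖w‖ ^ 2) 0 := by fun_prop
  have hint : Integrable fun w : ℂ => max (1 - ε ^ 2 * ‖w‖ ^ 2) 0 := by
    refine hcont.integrable_of_hasCompactSupport
      (HasCompactSupport.intro (isCompact_closedBall (0 : ℂ) ε⁻¹) fun w hw => ?_)
    have h1 : ε⁻¹ ≤ ‖w‖ := by simpa using (not_le.1 (by simpa using hw)).le
    have h2 : 1 ≤ ε * ‖w‖ := by
      have := mul_le_mul_of_nonneg_left h1 hε.le
      rwa [mul_inv_cancel₀ hε.ne'] at this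
    have h3 := one_le_pow₀ (n := 2) h2
    rw [mul_pow] at h3
    exact max_eq_right (by linarith)
  calc ∫ w in g '' K, (1 - ε ^ 2 * ‖w‖ ^ 2)
      ≤ ∫ w in g '' K, max (1 - ε ^ 2 * ‖w‖ ^ 2) 0 := by
        refine setIntegral_mono ?_ hint.integrableOn fun w => le_max_left _ _
        exact ContinuousOn.integrableOn_compact (hK.image_of_continuousOn hgc)
          (by fun_prop)
    _ ≤ _ := setIntegral_le_integral hint (.of_forall hpos)

theorem integral_two_pi_mul_pow_bound {ε s : ℝ} (hε : 0 < ε) (hs : 0 < s) (c : ℕ → ℝ) (M : ℝ)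
    (N : ℕ) :
    ∫ r in ε..s, 2 * π * (r⁻¹ ^ 3 + ∑ n ∈ Finset.range N, (n + 1) ^ 2 * c n * r ^ (2 * n + 1)
        - ε ^ 2 * r⁻¹ ^ 5 - ε ^ 2 * M * r) =
      π * ((ε⁻¹ ^ 2 - s⁻¹ ^ 2) +
        ∑ n ∈ Finset.range N, (n + 1) * c n * (s ^ (2 * n + 2) - ε ^ (2 * n + 2))
        - ε ^ 2 / 2 * (ε⁻¹ ^ 4 - s⁻¹ ^ 4) - ε ^ 2 * M * (s ^ 2 - ε ^ 2)) := by
  have hne : ∀ r ∈ Set.uIcc ε s, r ≠ 0 := fun r hr =>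
    (lt_of_lt_of_le (lt_min hε hs) hr.1).ne'
  rw [intervalIntegral.integral_eq_sub_of_hasDerivAt (f := fun r => π * (-r⁻¹ ^ 2 +
    ∑ n ∈ Finset.range N, (n + 1) * c n * r ^ (2 * n + 2) + ε ^ 2 / 2 * r⁻¹ ^ 4
      - ε ^ 2 * M * r ^ 2))]
  · simp only [mul_sub, Finset.sum_sub_distrib]
    ring
  · intro r hr
    have h0 := hne r hr
    have hi := hasDerivAt_inv h0
    have hsum : HasDerivAt (fun r : ℝ => ∑ n ∈ Finset.range N, (n + 1) * c n * r ^ (2 * n + 2))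
        (∑ n ∈ Finset.range N, (n + 1) * c n * ((2 * n + 2 : ℕ) * r ^ (2 * n + 1))) r :=
      HasDerivAt.fun_sum fun n _ => (hasDerivAt_pow (2 * n + 2) r).const_mul _
    have := (((((hi.pow 2).neg.add hsum).add ((hi.pow 4).const_mul (ε ^ 2 / 2))).sub
      ((hasDerivAt_pow 2 r).const_mul (ε ^ 2 * M))).const_mul π)
    refine this.congr_deriv ?_
    -- Differentiating `r ^ (2n + 2)` supplies the second factor `n + 1`, together with a `2`.
    have e : ∑ n ∈ Finset.range N, (n + 1) * c n * ((2 * n + 2 : ℕ) * r ^ (2 * n + 1)) =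
        2 * ∑ n ∈ Finset.range N, (n + 1) ^ 2 * c n * r ^ (2 * n + 1) := by
      rw [Finset.mul_sum]
      refine Finset.sum_congr rfl fun n _ => ?_
      push_cast; ring
    rw [e]
    push_cast
    field_simp
    ring
  · apply ContinuousOn.intervalIntegrable
    have : ContinuousOn (fun r : ℝ => r⁻¹) (Set.uIcc ε s) := continuousOn_id.inv₀ hne
    fun_prop

/-- Expanding the weight leaves the means of `|g'|²` and `ε² |g g'|²`, where `g = z⁻¹ + G`. Bessel's
inequality bounds the first below; the second is `ε² r⁻⁶` plus a bounded error. It matters that `M`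
depends on neither `ε` nor `r`, since `ε → 0` later. -/
theorem circleAverage_weight_ge {G : ℂ → ℂ} (hG : DifferentiableOn ℂ G (Metric.ball 0 1))
    (hG0 : G 0 = 0) {s : ℝ} (hs1 : s < 1) (N : ℕ) :
    ∃ M : ℝ, 0 ≤ M ∧ ∀ ε r : ℝ, 0 < r → r ≤ s →
      r⁻¹ ^ 4 + ∑ n ∈ Finset.range N, (n + 1) ^ 2 * ‖taylorCoeff G (n + 1)‖ ^ 2 * r ^ (2 * n)
        - ε ^ 2 * r⁻¹ ^ 6 - ε ^ 2 * M ≤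
      circleAverage (fun z => (1 - ε ^ 2 * ‖z⁻¹ + G z‖ ^ 2) * ‖-(z ^ 2)⁻¹ + deriv G z‖ ^ 2)
        0 r := by
  set P := dslope G 0
  have hP : DifferentiableOn ℂ P (Metric.ball 0 1) := hG.dslope_unitBall
  have hGP : ∀ z, G z = z * P z := fun z => by
    have := eq_add_mul_dslope G z
    rwa [hG0, zero_add] at this
  have hG' : DifferentiableOn ℂ (deriv G) (Metric.ball 0 1) := hG.deriv Metric.isOpen_ball
  have hP' : DifferentiableOn ℂ (deriv P) (Metric.ball 0 1) := hP.deriv Metric.isOpen_ball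
  set H : ℂ → ℂ := fun z => deriv P z + G z * deriv G z
  have hH : DifferentiableOn ℂ H (Metric.ball 0 1) := hP'.add (hG.mul hG')
  have hGd : ∀ z ∈ Metric.ball (0 : ℂ) 1, deriv G z = P z + z * deriv P z := fun z hz => by
    have hPz := (hP.differentiableAt (Metric.isOpen_ball.mem_nhds hz)).hasDerivAt
    have : HasDerivAt G (1 * P z + z * deriv P z) z :=
      ((hasDerivAt_id z).mul hPz).congr_of_eventuallyEq (.of_forall hGP)
    rw [this.deriv, one_mul]
  obtain ⟨C, hC⟩ := (isCompact_closedBall (0 : ℂ) s).exists_bound_of_continuousOn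
    (hH.continuousOn.mono (Metric.closedBall_subset_ball hs1))
  refine ⟨C ^ 2, sq_nonneg _, fun ε r h0 hrs => ?_⟩
  have h1 : r < 1 := hrs.trans_lt hs1
  have hsph := sphere_subset_unitBall h0.le h1
  have hz0 : ∀ z ∈ Metric.sphere (0 : ℂ) |r|, z ≠ 0 := by
    rintro z hz rfl
    simp [abs_of_pos h0] at hz
    exact h0.ne hz
  have hinv : ∀ k : ℕ, ContinuousOn (fun z : ℂ => -(z ^ k)⁻¹) (Metric.sphere 0 |r|) := fun k =>
    ((continuousOn_id.pow k).inv₀ fun z hz => pow_ne_zero k (hz0 z hz)).neg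
  have e : circleAverage (fun z => (1 - ε ^ 2 * ‖z⁻¹ + G z‖ ^ 2) * ‖-(z ^ 2)⁻¹ + deriv G z‖ ^ 2)
      0 r = circleAverage (fun z => ‖-(z ^ 2)⁻¹ + deriv G z‖ ^ 2 -
        ε ^ 2 • ‖-(z ^ 3)⁻¹ + H z‖ ^ 2) 0 r := by
    refine circleAverage_congr_sphere fun z hz => ?_
    have hz' := hz0 z hz
    -- This is `g g'`, the derivative of `g² / 2`, so it has no `z⁻¹` term; since `G 0 = 0` it has
    -- no `z⁻²` term either. Its only singular part is `-z⁻³`.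
    have : -(z ^ 3)⁻¹ + H z = (z⁻¹ + G z) * (-(z ^ 2)⁻¹ + deriv G z) := by
      simp only [H, hGP, hGd z (hsph hz)]
      field_simp
      ring
    simp only [this, norm_mul, smul_eq_mul]
    ring
  have c1 : CircleIntegrable (fun z => ‖-(z ^ 2)⁻¹ + deriv G z‖ ^ 2) 0 r :=
    (((hinv 2).add (hG'.continuousOn.mono hsph)).norm.pow 2).circleIntegrable'
  have c2 : CircleIntegrable (fun z => ‖-(z ^ 3)⁻¹ + H z‖ ^ 2) 0 r :=
    (((hinv 3).add (hH.continuousOn.mono hsph)).norm.pow 2).circleIntegrable'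
  have c3 : CircleIntegrable (fun z => ‖H z‖ ^ 2) 0 r :=
    ((hH.continuousOn.mono hsph).norm.pow 2).circleIntegrable'
  have c4 : CircleIntegrable (fun z => ε ^ 2 • ‖-(z ^ 3)⁻¹ + H z‖ ^ 2) 0 r := c2.const_smul
  rw [e, circleAverage_fun_sub c1 c4, circleAverage_fun_smul,
    circleAverage_normSq_inv_pow_add h0 h1 hG' two_ne_zero,
    circleAverage_normSq_inv_pow_add h0 h1 hH three_ne_zero]
  have b1 := sum_taylorCoeff_le_circleAverage h0.le h1 hG' N
  have b2 : circleAverage (fun z => ‖H z‖ ^ 2) 0 r ≤ C ^ 2 :=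
    circleAverage_mono_on_of_le_circle c3 fun z hz => by
      simp only [mem_sphere_zero_iff_norm, abs_of_pos h0] at hz
      gcongr
      exact hC z (by simpa [hz] using hrs)
  have b3 := mul_le_mul_of_nonneg_left b2 (sq_nonneg ε)
  have b4 : ∑ n ∈ Finset.range N, ((n : ℝ) + 1) ^ 2 * ‖taylorCoeff G (n + 1)‖ ^ 2 * r ^ (2 * n) =
      ∑ n ∈ Finset.range N, ‖taylorCoeff (deriv G) n‖ ^ 2 * r ^ (2 * n) := by
    refine Finset.sum_congr rfl fun n _ => ?_
    have : ‖(n + 1 : ℂ)‖ = n + 1 := by exact_mod_cast Complex.norm_natCast (n + 1)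
    rw [taylorCoeff_deriv, norm_mul, mul_pow, this]
  rw [b4]
  simp only [smul_eq_mul, inv_pow, mul_add]
  norm_num
  linarith

/-- **Gronwall's area theorem**: if `z⁻¹ + G z` is injective in the punctured unit disk, then
`∑ n ‖b_n‖ ^ 2 ≤ 1` for the Taylor coefficients `b_n` of `G`. -/
theorem area_theorem {G : ℂ → ℂ} (hG : DifferentiableOn ℂ G (Metric.ball 0 1)) (hG0 : G 0 = 0)
    (hinj : Set.InjOn (fun z => z⁻¹ + G z) (Metric.ball 0 1 \ {0})) (N : ℕ) :
    ∑ n ∈ Finset.range N, (n + 1) * ‖taylorCoeff G (n + 1)‖ ^ 2 ≤ 1 := by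
  set c : ℕ → ℝ := fun n => ‖taylorCoeff G (n + 1)‖ ^ 2
  have key : ∀ s : ℝ, 0 < s → s < 1 →
      ∑ n ∈ Finset.range N, (n + 1) * c n * s ^ (2 * n + 2) ≤ s⁻¹ ^ 2 := by
    intro s hs0 hs1
    obtain ⟨M, hM, hav⟩ := circleAverage_weight_ge hG hG0 hs1 N
    have bound : ∀ ε : ℝ, 0 < ε → ε < s →
        ∑ n ∈ Finset.range N, (n + 1) * c n * (s ^ (2 * n + 2) - ε ^ (2 * n + 2)) ≤
          s⁻¹ ^ 2 + ε ^ 2 * M := by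
      intro ε hε hεs
      set K : Set ℂ := {z | ε ≤ ‖z‖ ∧ ‖z‖ ≤ s} with hKdef
      have hKsub : K ⊆ Metric.ball 0 1 \ {0} := fun z hz =>
        ⟨by simpa using hz.2.trans_lt hs1, by
          rintro rfl
          have := hz.1
          simp at this
          linarith⟩
      have hKc : IsCompact K := by
        refine (isCompact_closedBall (0 : ℂ) s).of_isClosed_subset ?_ fun z hz => by
          simpa using hz.2
        exact (isClosed_le continuous_const continuous_norm).inter
          (isClosed_le continuous_norm continuous_const)
      have hder : ∀ z ∈ K, HasDerivAt (fun z => z⁻¹ + G z) (-(z ^ 2)⁻¹ + deriv G z) z :=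
        fun z hz => (hasDerivAt_inv (hKsub hz).2).add
          (hG.differentiableAt (Metric.isOpen_ball.mem_nhds (hKsub hz).1)).hasDerivAt
      have hup := setIntegral_weight_le hKc hder (hinj.mono hKsub) hε
      have hKcont : ContinuousOn
          (fun z => (1 - ε ^ 2 * ‖z⁻¹ + G z‖ ^ 2) * ‖-(z ^ 2)⁻¹ + deriv G z‖ ^ 2) K := by
        have h1 : ContinuousOn (fun z => z⁻¹ + G z) K := fun z hz =>
          (hder z hz).continuousAt.continuousWithinAt
        have h2 : ContinuousOn (fun z => -(z ^ 2)⁻¹ + deriv G z) K :=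
          ((continuousOn_id.pow 2).inv₀ fun z hz => pow_ne_zero 2 (hKsub hz).2).neg.add
            ((hG.deriv Metric.isOpen_ball).continuousOn.mono fun z hz => (hKsub hz).1)
        exact (continuousOn_const.sub (continuousOn_const.mul (h1.norm.pow 2))).mul
          (h2.norm.pow 2)
      rw [setIntegral_annulus hε hεs.le hKcont] at hup
      have hlow : ∫ r in ε..s, 2 * π * (r⁻¹ ^ 3 +
            ∑ n ∈ Finset.range N, (n + 1) ^ 2 * c n * r ^ (2 * n + 1)
            - ε ^ 2 * r⁻¹ ^ 5 - ε ^ 2 * M * r) ≤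
          ∫ r in ε..s, 2 * π * r * circleAverage
            (fun z => (1 - ε ^ 2 * ‖z⁻¹ + G z‖ ^ 2) * ‖-(z ^ 2)⁻¹ + deriv G z‖ ^ 2) 0 r := by
        have hne : ∀ r ∈ Set.uIcc ε s, r ≠ 0 := fun r hr => by
          rw [Set.uIcc_of_le hεs.le] at hr
          exact (hε.trans_le hr.1).ne'
        refine intervalIntegral.integral_mono_on hεs.le ?_ ?_ fun r hr => ?_
        · apply ContinuousOn.intervalIntegrable
          have : ContinuousOn (fun r : ℝ => r⁻¹) (Set.uIcc ε s) := continuousOn_id.inv₀ hne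
          fun_prop
        · apply ContinuousOn.intervalIntegrable
          rw [Set.uIcc_of_le hεs.le]
          refine ContinuousOn.mul (by fun_prop) (ContinuousOn.circleAverage ?_ fun r hr =>
            hε.le.trans hr.1)
          simpa [hKdef, Set.mem_Icc] using hKcont
        · have hr0 : 0 < r := hε.trans_le hr.1
          have := mul_le_mul_of_nonneg_left (hav ε r hr0 hr.2)
            (by positivity : 0 ≤ 2 * π * r)
          refine le_trans (le_of_eq ?_) this
          have e : ∑ n ∈ Finset.range N, ((n : ℝ) + 1) ^ 2 * c n * r ^ (2 * n + 1) =
              r * ∑ n ∈ Finset.range N, ((n : ℝ) + 1) ^ 2 * c n * r ^ (2 * n) := by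
            rw [Finset.mul_sum]
            exact Finset.sum_congr rfl fun n _ => by ring
          rw [e]
          simp only [c]
          field_simp
      rw [integral_two_pi_mul_pow_bound hε hs0] at hlow
      have hfin := hlow.trans hup
      have hπ : π / (2 * ε ^ 2) = π * (ε⁻¹ ^ 2 / 2) := by field_simp
      rw [hπ] at hfin
      have hfin := le_of_mul_le_mul_left hfin pi_pos
      -- Taking the inner radius equal to the parameter of the weight makes the singular terms
      -- match: `ε⁻² - ε⁻² / 2` below against `ε⁻² / 2` above.
      have h1 : ε ^ 2 / 2 * (ε⁻¹ ^ 4 - s⁻¹ ^ 4) = ε⁻¹ ^ 2 / 2 - ε ^ 2 / 2 * s⁻¹ ^ 4 := by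
        field_simp
      have h2 : 0 ≤ ε ^ 2 / 2 * s⁻¹ ^ 4 := by positivity
      have h3 : ε ^ 2 * M * (s ^ 2 - ε ^ 2) ≤ ε ^ 2 * M * 1 := by
        gcongr
        have : s ^ 2 ≤ 1 := pow_le_one₀ hs0.le hs1.le
        linarith [sq_nonneg ε]
      rw [h1] at hfin
      linarith
    have hl : Filter.Tendsto (fun ε : ℝ => ∑ n ∈ Finset.range N,
        ((n : ℝ) + 1) * c n * (s ^ (2 * n + 2) - ε ^ (2 * n + 2))) (nhdsWithin 0 (Set.Ioi 0))
        (nhds (∑ n ∈ Finset.range N, (n + 1) * c n * s ^ (2 * n + 2))) := by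
      refine Filter.Tendsto.mono_left ?_ nhdsWithin_le_nhds
      refine Continuous.tendsto' (by fun_prop) _ _ (by simp)
    have hr : Filter.Tendsto (fun ε : ℝ => s⁻¹ ^ 2 + ε ^ 2 * M) (nhdsWithin 0 (Set.Ioi 0))
        (nhds (s⁻¹ ^ 2)) := by
      refine Filter.Tendsto.mono_left ?_ nhdsWithin_le_nhds
      refine Continuous.tendsto' (by fun_prop) _ _ (by simp)
    refine le_of_tendsto_of_tendsto hl hr ?_
    filter_upwards [Ioo_mem_nhdsGT hs0] with ε hε using bound ε hε.1 hε.2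
  have hl : Filter.Tendsto (fun s : ℝ => ∑ n ∈ Finset.range N,
      ((n : ℝ) + 1) * c n * s ^ (2 * n + 2)) (nhdsWithin 1 (Set.Iio 1))
      (nhds (∑ n ∈ Finset.range N, (n + 1) * c n)) := by
    refine Filter.Tendsto.mono_left ?_ nhdsWithin_le_nhds
    refine Continuous.tendsto' (by fun_prop) _ _ (by simp)
  have hr : Filter.Tendsto (fun s : ℝ => s⁻¹ ^ 2) (nhdsWithin 1 (Set.Iio 1)) (nhds 1) := by
    refine Filter.Tendsto.mono_left ?_ nhdsWithin_le_nhds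
    have : ContinuousAt (fun s : ℝ => s⁻¹ ^ 2) 1 := (continuousAt_inv₀ one_ne_zero).pow 2
    simpa [ContinuousAt] using this
  refine le_of_tendsto_of_tendsto hl hr ?_
  filter_upwards [Ioo_mem_nhdsLT one_pos] with s hs using key s hs.1 hs.2

/-! ### The square root transform -/

/-- A primitive `L` of `h' / h` is a logarithm of `h`, because `exp (-L) * h` has derivative zero;
then `m = exp (-L / 2)`. -/
theorem exists_sq_eq_of_ne_zero {h : ℂ → ℂ} (hh : DifferentiableOn ℂ h (Metric.ball 0 1))
    (h0 : h 0 = 1) (hne : ∀ z ∈ Metric.ball (0 : ℂ) 1, h z ≠ 0) :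
    ∃ m : ℂ → ℂ, DifferentiableOn ℂ m (Metric.ball 0 1) ∧ m 0 = 1 ∧
      ∀ z ∈ Metric.ball (0 : ℂ) 1, m z ^ 2 * h z = 1 := by
  have hd : DifferentiableOn ℂ (fun z => deriv h z / h z) (Metric.ball 0 1) :=
    (hh.deriv Metric.isOpen_ball).div hh hne
  obtain ⟨L, hL, hL'⟩ := hd.isExactOn_ball.with_val_at 0 0
  have hu : ∀ z ∈ Metric.ball (0 : ℂ) 1, HasDerivAt (fun z => Complex.exp (-L z) * h z) 0 z := by
    intro z hz
    have hd := (hh.differentiableAt (Metric.isOpen_ball.mem_nhds hz)).hasDerivAt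
    refine ((hL' z hz).neg.cexp.mul hd).congr_deriv ?_
    have := hne z hz
    field_simp
    ring
  refine ⟨fun z => Complex.exp (-L z / 2), fun z hz => ?_, by simp [hL], fun z hz => ?_⟩
  · exact ((hL' z hz).neg.div_const 2).cexp.differentiableAt.differentiableWithinAt
  · have := Metric.isOpen_ball.is_const_of_deriv_eq_zero (convex_ball (0 : ℂ) 1).isPreconnected
      (fun z hz => (hu z hz).differentiableAt.differentiableWithinAt)
      (fun z hz => (hu z hz).deriv) hz (Metric.mem_ball_self one_pos)
    simp only [hL, h0, neg_zero, Complex.exp_zero, mul_one] at this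
    rw [← this, ← Complex.exp_nat_mul]
    push_cast
    ring_nf

theorem ClassS.exists_sqrt {f : ℂ → ℂ} (hf : f ∈ ClassS) :
    ∃ m : ℂ → ℂ, DifferentiableOn ℂ m (Metric.ball 0 1) ∧ m 0 = 1 ∧
      ∀ z ∈ Metric.ball (0 : ℂ) 1, m z * m z * f z = z := by
  obtain ⟨hfa, hinj, hf0, hf1⟩ := hf
  have h0 : (0 : ℂ) ∈ Metric.ball (0 : ℂ) 1 := by simp
  have hfz : ∀ z, f z = z * dslope f 0 z := fun z => by
    have := eq_add_mul_dslope f z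
    rwa [hf0, zero_add] at this
  obtain ⟨m, hm, hm0, hmh⟩ := exists_sq_eq_of_ne_zero (hfa.differentiableOn.dslope_unitBall)
    (by rw [dslope_same, hf1]) fun z hz hzero => by
      -- Away from `0`, a zero of `dslope f 0` would be a second zero of `f`, against injectivity.
      by_cases hz0 : z = 0
      · rw [hz0, dslope_same, hf1] at hzero
        exact one_ne_zero hzero
      · exact hz0 (hinj hz h0 (by rw [hfz z, hzero, mul_zero, hf0]))
  refine ⟨m, hm, hm0, fun z hz => ?_⟩
  rw [hfz z]
  linear_combination z * hmh z hz

theorem sq_mem_unitBall {z : ℂ} (hz : z ∈ Metric.ball (0 : ℂ) 1) :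
    z ^ 2 ∈ Metric.ball (0 : ℂ) 1 := by
  simp only [mem_ball_zero_iff, norm_pow] at hz ⊢
  exact pow_lt_one₀ (norm_nonneg z) hz two_ne_zero

/-- If `m ^ 2 * f = id` with `f` injective, then `m (z ^ 2) / z`, the reciprocal of the square root
transform of `f`, is injective in the punctured disk. -/
theorem injOn_sqrt_transform {f m : ℂ → ℂ} (hinj : Set.InjOn f (Metric.ball 0 1))
    (hm : ∀ z ∈ Metric.ball (0 : ℂ) 1, m z * m z * f z = z) :
    Set.InjOn (fun z => m (z ^ 2) / z) (Metric.ball 0 1 \ {0}) := by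
  rintro z ⟨hz, hz0⟩ w ⟨hw, hw0⟩ (h : m (z ^ 2) / z = m (w ^ 2) / w)
  have hz0 : z ≠ 0 := hz0
  have hw0 : w ≠ 0 := hw0
  have ez := hm _ (sq_mem_unitBall hz)
  have ew := hm _ (sq_mem_unitBall hw)
  have hmz : m (z ^ 2) ≠ 0 := fun h0 => by
    rw [h0] at ez; exact pow_ne_zero 2 hz0 (by rw [← ez]; ring)
  have hmw : m (w ^ 2) ≠ 0 := fun h0 => by
    rw [h0] at ew; exact pow_ne_zero 2 hw0 (by rw [← ew]; ring)
  have fz : (m (z ^ 2) / z) ^ 2 * f (z ^ 2) = 1 := by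
    rw [div_pow, div_mul_eq_mul_div, div_eq_one_iff_eq (pow_ne_zero 2 hz0)]
    linear_combination ez
  have fw : (m (w ^ 2) / w) ^ 2 * f (w ^ 2) = 1 := by
    rw [div_pow, div_mul_eq_mul_div, div_eq_one_iff_eq (pow_ne_zero 2 hw0)]
    linear_combination ew
  have hff : f (z ^ 2) = f (w ^ 2) := by
    rw [← h] at fw
    exact mul_left_cancel₀ (pow_ne_zero 2 (div_ne_zero hmz hz0)) (fz.trans fw.symm)
  have hsq := hinj (sq_mem_unitBall hz) (sq_mem_unitBall hw) hff
  -- With `z ^ 2 = w ^ 2` the numerators agree, so the sign ambiguity is settled by the odd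
  -- denominator.
  rw [hsq] at h
  exact ((div_eq_div_iff hz0 hw0).1 h |> mul_left_cancel₀ hmw).symm

theorem differentiableOn_comp_sq {F : ℂ → ℂ} (hF : DifferentiableOn ℂ F (Metric.ball 0 1)) :
    DifferentiableOn ℂ (fun z => F (z ^ 2)) (Metric.ball 0 1) :=
  hF.comp (differentiableOn_id.pow 2) fun _ hz => sq_mem_unitBall hz

theorem taylorCoeff_comp_sq {F : ℂ → ℂ} (hF : DifferentiableOn ℂ F (Metric.ball 0 1)) (n : ℕ) :
    taylorCoeff (fun z => F (z ^ 2)) (2 * n) = taylorCoeff F n := by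
  induction n generalizing F with
  | zero => simp [taylorCoeff_zero]
  | succ n ih =>
    have hd := differentiableOn_comp_sq hF.dslope_unitBall
    -- The summand `0` puts the function in the form `c + z * F z` twice, so that two indices can be
    -- peeled off.
    have e : (fun z => F (z ^ 2)) =
        fun z => F 0 + z * (0 + z * (fun z => dslope F 0 (z ^ 2)) z) := by
      funext z
      rw [eq_add_mul_dslope F (z ^ 2)]
      ring
    have ha : AnalyticAt ℂ (fun z => dslope F 0 (z ^ 2)) 0 := .of_differentiableOn_unitBall hd
    rw [e, show 2 * (n + 1) = 2 * n + 1 + 1 by ring,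
      taylorCoeff_const_add_mul_succ (F 0) (F := fun z => 0 + z * (fun z => dslope F 0 (z ^ 2)) z)
        (analyticAt_const.add (analyticAt_id.mul ha)),
      taylorCoeff_const_add_mul_succ _ ha, ih hF.dslope_unitBall, taylorCoeff_dslope hF]

/-- The coefficient inequality for `f` in the class `𝒮` obtained from the area theorem applied to
the square root transform. -/
theorem sum_sqrt_taylorCoeff_le {f m : ℂ → ℂ} (hinj : Set.InjOn f (Metric.ball 0 1))
    (hmd : DifferentiableOn ℂ m (Metric.ball 0 1)) (hm0 : m 0 = 1)
    (hm : ∀ z ∈ Metric.ball (0 : ℂ) 1, m z * m z * f z = z) :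
    ‖taylorCoeff m 1‖ ^ 2 + 3 * ‖taylorCoeff m 2‖ ^ 2 + 5 * ‖taylorCoeff m 3‖ ^ 2 ≤ 1 := by
  have hp := hmd.dslope_unitBall
  have hp2 := differentiableOn_comp_sq hp
  have hG : DifferentiableOn ℂ (fun z => 0 + z * dslope m 0 (z ^ 2)) (Metric.ball 0 1) :=
    (differentiableOn_id.mul hp2).const_add 0
  have hinjg : Set.InjOn (fun z => z⁻¹ + (0 + z * dslope m 0 (z ^ 2)))
      (Metric.ball 0 1 \ {0}) := by
    refine (injOn_sqrt_transform hinj hm).congr fun z hz => ?_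
    have hz0 : z ≠ 0 := hz.2
    simp only
    rw [eq_add_mul_dslope m (z ^ 2), hm0]
    field_simp
    ring
  -- Five terms reach the coefficient of `z ^ 5`, which is `m₃`; the even-index terms are
  -- nonnegative and are dropped at the end.
  have h := area_theorem hG (by simp) hinjg 5
  have hc : ∀ n, taylorCoeff (fun z => 0 + z * dslope m 0 (z ^ 2)) (2 * n + 1) =
      taylorCoeff m (n + 1) := fun n => by
    rw [taylorCoeff_const_add_mul_succ 0 (.of_differentiableOn_unitBall hp2),
      taylorCoeff_comp_sq hp, taylorCoeff_dslope hmd]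
  have h0 := hc 0
  have h1 := hc 1
  have h2 := hc 2
  norm_num at h0 h1 h2
  norm_num [Finset.sum_range_succ] at h
  rw [h0, h1, h2] at h
  nlinarith [sq_nonneg ‖taylorCoeff (fun z => z * dslope m 0 (z ^ 2)) 2‖,
    sq_nonneg ‖taylorCoeff (fun z => z * dslope m 0 (z ^ 2)) 4‖]

/-! ### The coefficient relation and the final estimate -/

theorem ClassS.taylorCoeff_relations {f m : ℂ → ℂ} (hf : f ∈ ClassS)
    (hmd : DifferentiableOn ℂ m (Metric.ball 0 1)) (hm0 : m 0 = 1)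
    (hm : ∀ z ∈ Metric.ball (0 : ℂ) 1, m z * m z * f z = z) :
    taylorCoeff f 4 + taylorCoeff m 1 * taylorCoeff f 3 =
      -taylorCoeff m 1 ^ 3 + 4 * taylorCoeff m 1 * taylorCoeff m 2 - 2 * taylorCoeff m 3 := by
  have hma : AnalyticAt ℂ m 0 := .of_differentiableOn_unitBall hmd
  have hfa : AnalyticAt ℂ f 0 := hf.1 0 (by simp)
  obtain ⟨f0, f1⟩ := ClassS.taylorCoeff_zero_one hf
  have m0 : taylorCoeff m 0 = 1 := by rw [taylorCoeff_zero, hm0]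
  have hev : (fun z => (fun z => m z * m z) z * f z) =ᶠ[nhds 0] fun z => z := by
    filter_upwards [Metric.ball_mem_nhds (0 : ℂ) one_pos] with z hz using hm z hz
  have key : ∀ n, ∑ i ∈ Finset.range (n + 1), (∑ j ∈ Finset.range (i + 1),
      taylorCoeff m j * taylorCoeff m (i - j)) * taylorCoeff f (n - i) =
        if n = 1 then 1 else 0 := fun n => by
    rw [← taylorCoeff_id, ← taylorCoeff_congr hev,
      taylorCoeff_mul (f := fun z => m z * m z) (hma.mul hma) hfa]
    exact Finset.sum_congr rfl fun i _ => by rw [taylorCoeff_mul hma hma]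
  have k2 := key 2
  have k3 := key 3
  have k4 := key 4
  simp [Finset.sum_range_succ, f0, f1, m0] at k2 k3 k4
  have e2 : taylorCoeff f 2 = -2 * taylorCoeff m 1 := by linear_combination k2
  have e3 : taylorCoeff f 3 = 3 * taylorCoeff m 1 ^ 2 - 2 * taylorCoeff m 2 := by
    rw [e2] at k3
    linear_combination k3
  rw [e2, e3] at k4
  rw [e3]
  linear_combination k4

theorem four_mul_add_cube_le {a b c : ℝ} (ha : 0 ≤ a)
    (h : a ^ 2 + 3 * b ^ 2 + 5 * c ^ 2 ≤ 1) : a ^ 3 + 4 * a * b + 2 * c ≤ 2.1 := by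
  have ha1 : a ≤ 1 := by nlinarith [sq_nonneg b, sq_nonneg c]
  -- The weights are chosen so that everything is dominated by `2 (a² + 3b² + 5c²) + 0.1`: `b²` and
  -- `c²` use up their full shares `6` and `10`, while `a²` needs only `1 + 2/3 ≤ 2`.
  have h1 : 4 * a * b ≤ 6 * b ^ 2 + 2 / 3 * a ^ 2 := by nlinarith [sq_nonneg (3 * b - a)]
  have h2 : 2 * c ≤ 10 * c ^ 2 + 0.1 := by nlinarith [sq_nonneg (10 * c - 1)]
  have h3 : a ^ 3 ≤ a ^ 2 := pow_le_pow_of_le_one ha ha1 (by norm_num)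
  nlinarith [sq_nonneg a]

theorem theorem3 (f : ℂ → ℂ) (hf : f ∈ ClassS) :
    ‖taylorCoeff f 4‖ - ‖taylorCoeff f 3‖ ≤ (2.1033299 : ℝ) := by
  obtain ⟨m, hmd, hm0, hm⟩ := ClassS.exists_sqrt hf
  have hsum := sum_sqrt_taylorCoeff_le hf.2.1 hmd hm0 hm
  have hrel := ClassS.taylorCoeff_relations hf hmd hm0 hm
  set a := taylorCoeff m 1
  set b := taylorCoeff m 2
  set c := taylorCoeff m 3
  have ha : ‖a‖ ≤ 1 := by nlinarith [sq_nonneg ‖b‖, sq_nonneg ‖c‖, norm_nonneg a]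
  have h1 : ‖taylorCoeff f 4‖ ≤
      ‖taylorCoeff f 4 + a * taylorCoeff f 3‖ + ‖a‖ * ‖taylorCoeff f 3‖ := by
    rw [← norm_mul]
    simpa using norm_sub_le (taylorCoeff f 4 + a * taylorCoeff f 3) (a * taylorCoeff f 3)
  -- The cost of adding `a * a₃` is absorbed by the subtracted `|a₃|`.
  have h2 : ‖a‖ * ‖taylorCoeff f 3‖ ≤ ‖taylorCoeff f 3‖ :=
    mul_le_of_le_one_left (norm_nonneg _) ha
  have h3 : ‖-a ^ 3 + 4 * a * b - 2 * c‖ ≤ ‖a‖ ^ 3 + 4 * ‖a‖ * ‖b‖ + 2 * ‖c‖ := by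
    refine (norm_sub_le _ _).trans ((add_le_add_left (norm_add_le _ _) _).trans (le_of_eq ?_))
    simp
  have h4 := four_mul_add_cube_le (norm_nonneg a) hsum
  rw [hrel] at h1
  norm_num at h4 ⊢
  linarith
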